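/- Let $d\ge 1$ and $n\ge 0$ be integers, let $q$ be an indeterminate and $R=\mathbb{C}[q,q^{-1}]$. Let $\mathrm{Y}_{d,n}(q)$ be the Yokonuma–Hecke algebra, that is, the associative unital $R$-algebra generated by $g_1,\dots,g_{n-1},t_1,\dots,t_n$ subject to the relations $$g_ig_j=g_jg_i\ (|i-j|>1),\quad g_ig_{i+1}g_i=g_{i+1}g_ig_{i+1},\quad t_it_j=t_jt_i,\quad t_jg_i=g_it_{s_i(j)},\quad t_j^d=1,$$ $$g_i^2=1+(q-q^{-1})\,e_i\,g_i,\qquad e_i=\frac1d\sum_{s=0}^{d-1}t_i^{s}t_{i+1}^{-s},$$ where $s_i=(i,i+1)\in\mathfrak{S}_n$. For $w\in\mathfrak{S}_n$ put $g_w=g_{i_1}\cdots g_{i_r}$, where $w=s_{i_1}\cdots s_{i_r}$ is a reduced expression. Then $g_w$ does not depend on the choice of the reduced expression, and the elements $t_1^{k_1}\cdots t_n^{k_n}g_w$ with $w\in\mathfrak{S}_n$ and $k_1,\dots,k_n\in\mathbb{Z}/d\mathbb{Z}$ form an $R$-basis $\mathcal{B}$ of $\mathrm{Y}_{d,n}(q)$,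 so that there is exactly one $R$-linear map $\boldsymbol{\tau}:\mathrm{Y}_{d,n}(q)\to R$ with $$\boldsymbol{\tau}(t_1^{k_1}\cdots t_n^{k_n}g_w)=\begin{cases}1,&\text{if } w=1 \text{ and } k_i\equiv 0 \bmod d \text{ for all } i=1,\dots,n;\\ 0,&\text{otherwise.}\end{cases}$$ For all $w,w'\in\mathfrak{S}_n$ and all integers $k_1,\dots,k_n,l_1,\dots,l_n$ it satisfies $$\boldsymbol{\tau}(t_1^{k_1}\cdots t_n^{k_n}g_wg_{w'}t_1^{l_1}\cdots t_n^{l_n})=\begin{cases}1,&\text{if } w^{-1}=w' \text{ and } k_i+l_i\equiv 0 \bmod d \text{ for all } i=1,\dots,n;\\ 0,&\text{otherwise.}\end{cases}$$ Moreover, $\boldsymbol{\tau}$ is a symmetrising form, that is, $\boldsymbol{\tau}(aa')=\boldsymbol{\tau}(a'a)$ for all $a,a'\in\mathrm{Y}_{d,n}(q)$, and the determinant of the matrix $(\boldsymbol{\tau}(bb'))_{b\in B,\,b'\in B'}$ is a unit of $R$ for some $R$-bases $B,B'$ of $\mathrm{Y}_{d,n}(q)$. The basis dual to $\mathcal{B}$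 with respect to $\boldsymbol{\tau}$, that is, the basis $\{b^\vee\mid b\in\mathcal{B}\}$ with $\boldsymbol{\tau}(b^\vee b')=\delta_{b,b'}$ for all $b,b'\in\mathcal{B}$, is given by $$(t_1^{k_1}\cdots t_n^{k_n}g_w)^\vee=g_{w^{-1}}t_1^{d-k_1}\cdots t_n^{d-k_n}.$$ -/

import Mathlib

namespace YokonumaHecke

/-- The ground ring `ℂ[q, q⁻¹]`. -/
abbrev GroundRing : Type := LaurentPolynomial ℂ

/-- The indeterminate `q`. -/
noncomputable def q : GroundRing := LaurentPolynomial.T 1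

/-- The inverse `q⁻¹` of the indeterminate. -/
noncomputable def qInv : GroundRing := LaurentPolynomial.T (-1)

section Presentation

variable (d n : ℕ)

/-- The generators: `g i` for the `n - 1` simple transpositions, `t j` for the `n` strands
(indices start at `0`). -/
inductive Gen : Type
  | g (i : Fin (n - 1)) : Gen
  | t (j : Fin n) : Gen

variable {n}

/-- The index `i` among the `n` strands. -/
def lo (i : Fin (n - 1)) : Fin n := ⟨i.val, by have := i.isLt; omega⟩

/-- The index `i + 1` among the `n` strands. -/
def hi (i : Fin (n - 1)) : Fin n := ⟨i.val + 1, by have := i.isLt; omega⟩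

/-- The simple transposition `s_i = (i, i+1)`. -/
def s (i : Fin (n - 1)) : Equiv.Perm (Fin n) := Equiv.swap (lo i) (hi i)

/-- The letter `g_i` in the free algebra. -/
noncomputable def freeG (i : Fin (n - 1)) : FreeAlgebra GroundRing (Gen n) :=
  FreeAlgebra.ι GroundRing (Gen.g i)

/-- The letter `t_j` in the free algebra. -/
noncomputable def freeT (j : Fin n) : FreeAlgebra GroundRing (Gen n) :=
  FreeAlgebra.ι GroundRing (Gen.t j)

/-- `e_i = (1/d) ∑_{s=0}^{d-1} t_i^s t_{i+1}^{-s}`. In the free algebra the letters are not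
invertible, so `t_{i+1}^{-s}` is written `t_{i+1}^{d-s}`, with `d - s ≥ 1`; the two agree in the
quotient because `t_{i+1}^d = 1` there. -/
noncomputable def freeE (i : Fin (n - 1)) : FreeAlgebra GroundRing (Gen n) :=
  (LaurentPolynomial.C ((d : ℂ)⁻¹) : GroundRing) •
    ∑ s ∈ Finset.range d, freeT (lo i) ^ s * freeT (hi i) ^ (d - s)

/-- The defining relations. -/
inductive Rel : FreeAlgebra GroundRing (Gen n) → FreeAlgebra GroundRing (Gen n) → Prop
  | b1 (i j : Fin (n - 1)) (h : i.val + 1 < j.val ∨ j.val + 1 < i.val) :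
      Rel (freeG i * freeG j) (freeG j * freeG i)
  | b2 (i j : Fin (n - 1)) (h : j.val = i.val + 1) :
      Rel (freeG i * freeG j * freeG i) (freeG j * freeG i * freeG j)
  | f1 (i j : Fin n) : Rel (freeT i * freeT j) (freeT j * freeT i)
  | f2 (i : Fin (n - 1)) (j : Fin n) : Rel (freeT j * freeG i) (freeG i * freeT (s i j))
  | f3 (j : Fin n) : Rel (freeT j ^ d) 1
  | quad (i : Fin (n - 1)) : Rel (freeG i ^ 2) (1 + (q - qInv) • (freeE d i * freeG i))

variable (n)

/-- The Yokonuma--Hecke algebra `Y_{d,n}(q)` over `ℂ[q, q⁻¹]`. -/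
abbrev Y : Type := RingQuot (Rel d (n := n))

variable {n}

/-- The generator `g_i` of `Y_{d,n}(q)`. -/
noncomputable def g (i : Fin (n - 1)) : Y d n :=
  RingQuot.mkAlgHom GroundRing (Rel d) (freeG i)

/-- The generator `t_j` of `Y_{d,n}(q)`. -/
noncomputable def t (j : Fin n) : Y d n :=
  RingQuot.mkAlgHom GroundRing (Rel d) (freeT j)

theorem t_pow (j : Fin n) : (t d j : Y d n) ^ d = 1 := by
  rw [t, ← map_pow, RingQuot.mkAlgHom_rel GroundRing (Rel.f3 j), map_one]

/-- `t_j` as an invertible element of `Y_{d,n}(q)`. -/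
noncomputable def tUnit [NeZero d] (j : Fin n) : (Y d n)ˣ :=
  Units.ofPowEqOne (t d j) d (t_pow d j) (NeZero.ne d)

/-- The framing `t_1^{k_1} ⋯ t_n^{k_n}` (factors in increasing order), for integers `k_i`. -/
noncomputable def framing [NeZero d] (k : Fin n → ℤ) : Y d n :=
  (((List.ofFn fun i => tUnit d i ^ k i).prod : (Y d n)ˣ) : Y d n)

/-- `L = [i_1, …, i_r]` is a reduced expression of `w`: `w = s_{i_1} ⋯ s_{i_r}`, and no shorter
word in the simple transpositions represents `w`. -/
def IsReducedExpr (w : Equiv.Perm (Fin n)) (L : List (Fin (n - 1))) : Prop :=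
  (L.map s).prod = w ∧ ∀ L' : List (Fin (n - 1)), (L'.map s).prod = w → L.length ≤ L'.length

theorem exists_expr (w : Equiv.Perm (Fin n)) : ∃ L : List (Fin (n - 1)), (L.map s).prod = w := by
  cases n with
  | zero => exact ⟨[], Subsingleton.elim _ _⟩
  | succ m =>
    have hw : w ∈ Submonoid.closure
        (Set.range fun i : Fin m => Equiv.swap i.castSucc i.succ) := by
      rw [Equiv.Perm.mclosure_swap_castSucc_succ]; trivial
    induction hw using Submonoid.closure_induction with
    | mem x hx => obtain ⟨i, rfl⟩ := hx; exact ⟨[i], by simp; rfl⟩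
    | one => exact ⟨[], rfl⟩
    | mul x y _ _ hx hy =>
      obtain ⟨L, rfl⟩ := hx
      obtain ⟨L', rfl⟩ := hy
      exact ⟨L ++ L', by simp⟩

theorem exists_reducedExpr (w : Equiv.Perm (Fin n)) : ∃ L, IsReducedExpr w L := by
  have hne : {L : List (Fin (n - 1)) | (L.map s).prod = w}.Nonempty := exists_expr w
  exact ⟨Function.argminOn List.length _ hne, Function.argminOn_mem _ _ hne,
    fun L' hL' => Function.argminOn_le List.length _ hL'⟩

/-- `g_w = g_{i_1} ⋯ g_{i_r}` for a reduced expression `s_{i_1} ⋯ s_{i_r}` of `w`. -/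
noncomputable def gPerm (w : Equiv.Perm (Fin n)) : Y d n :=
  ((exists_reducedExpr w).choose.map (g d)).prod

end Presentation

/-- A symmetrising form on an `R`-algebra `A`, free and finitely generated as an `R`-module: a
linear form `τ` which is a trace function and for which the determinant of the matrix
`(τ (b b'))` is a unit of `R` for some bases `b`, `b'` of `A`. -/
structure IsSymmetrisingForm (R A : Type*) [CommRing R] [Ring A] [Algebra R A]
    (τ : A →ₗ[R] R) : Prop where
  trace : ∀ a a' : A, τ (a * a') = τ (a' * a)
  nondegenerate : ∃ (m : ℕ) (b b' : Module.Basis (Fin m) R A),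
    IsUnit (Matrix.of fun i j => τ (b i * b' j)).det

/-- The values defining the linear map `τ`: `τ (t_1^{k_1} ⋯ t_n^{k_n} g_w)` is `1` if `w = 1` and
`k_i ≡ 0 mod d` for all `i`, and `0` otherwise. -/
def IsTau (d : ℕ) [NeZero d] {n : ℕ} (τ : Y d n →ₗ[GroundRing] GroundRing) : Prop :=
  ∀ (k : Fin n → ℤ) (w : Equiv.Perm (Fin n)),
    ((w = 1 ∧ ∀ i, k i ≡ 0 [ZMOD d]) → τ (framing d k * gPerm d w) = 1) ∧
    (¬ (w = 1 ∧ ∀ i, k i ≡ 0 [ZMOD d]) → τ (framing d k * gPerm d w) = 0)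

end YokonumaHecke

/-! The length of a permutation is its number of inversions, and a word is reduced exactly when it
has that length. Induction on length, with the braid relations deciding the cases of two distinct
first letters, gives Matsumoto's theorem, so `gPerm` is computable from any reduced word
(`gPerm_eq`).

Spanning: framings move past each `g_i` with permuted exponents, and the quadratic relation reduces
`g_i g_w`; hence the span of the standard elements is stable under left multiplication by the
generators and contains `1`.

Independence: the algebra acts on functions of pairs (colouring in `(ℤ/d)^n`, permutation). Each
`t_j` acts diagonally through a faithful character of `ℤ/d`, so `e_i` becomes the projection onto
colourings that agree at `i` and `i+1`; `g_i` acts by a Hecke operator where those colours agree and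
by a plain swap elsewhere. On the indicator of the identity permutation, `t^k g_w` yields a
character of `(ℤ/d)^n` supported on `w`, and distinct characters with values in a domain are
independent.

Trace: induction on the length of `w`, passing one letter from `g_w` to `g_{w'}`, shows that `τ`
detects `w' = w⁻¹`; the terms containing `e_i` only add framings and vanish by induction. The
resulting formula is symmetric, and the dual family is a permutation of the standard basis, so it is
a basis and its Gram matrix against the standard basis is the identity. -/

namespace YokonumaHecke

/-! ### Inversions, length and reduced words. -/

section Length

variable {n : ℕ}

theorem lo_lt_hi (i : Fin (n - 1)) : lo i < hi i := by
  simp [lo, hi, Fin.lt_def]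

@[simp] theorem s_lo (i : Fin (n - 1)) : s i (lo i) = hi i := Equiv.swap_apply_left _ _

@[simp] theorem s_hi (i : Fin (n - 1)) : s i (hi i) = lo i := Equiv.swap_apply_right _ _

@[simp] theorem s_s_apply (i : Fin (n - 1)) (a : Fin n) : s i (s i a) = a := by simp [s]

@[simp] theorem s_mul_s (i : Fin (n - 1)) : s i * s i = 1 := Equiv.swap_mul_self _ _

@[simp] theorem s_mul_s_mul (i : Fin (n - 1)) (w : Equiv.Perm (Fin n)) : s i * (s i * w) = w := by
  rw [← mul_assoc, s_mul_s, one_mul]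

@[simp] theorem s_inv (i : Fin (n - 1)) : (s i)⁻¹ = s i := Equiv.swap_inv _ _

theorem s_apply_of_ne (i : Fin (n - 1)) {a : Fin n} (h : a ≠ lo i) (h' : a ≠ hi i) : s i a = a :=
  Equiv.swap_apply_of_ne_of_ne h h'

theorem s_lt_s (i : Fin (n - 1)) {a b : Fin n} (h : a < b) (hab : ¬ (a = lo i ∧ b = hi i)) :
    s i a < s i b := by
  simp only [s, Equiv.swap_apply_def, lo, hi, Fin.lt_def, Fin.ext_iff] at *
  split_ifs <;> simp_all <;> omega

/-- The inversions of `w⁻¹`. -/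
def inversions (w : Equiv.Perm (Fin n)) : Finset (Fin n × Fin n) :=
  Finset.univ.filter fun p => p.1 < p.2 ∧ w⁻¹ p.2 < w⁻¹ p.1

/-- The number of inversions of `w⁻¹` (or, equivalently, of `w`). -/
def permLength (w : Equiv.Perm (Fin n)) : ℕ := (inversions w).card

@[simp] theorem permLength_one : permLength (1 : Equiv.Perm (Fin n)) = 0 := by
  simp only [permLength, inversions, Finset.card_eq_zero, Finset.filter_eq_empty_iff]
  rintro ⟨a, b⟩ - ⟨h, h'⟩
  exact lt_asymm h h'

/-- Applying `s_i` to both entries carries the inversions of `w` to inversions of `s i * w`, since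
`s_i` reverses no pair except `(lo i, hi i)`; that pair is the single new inversion. -/
theorem permLength_s_mul_of_lt {i : Fin (n - 1)} {w : Equiv.Perm (Fin n)}
    (h : w⁻¹ (lo i) < w⁻¹ (hi i)) :
    permLength (s i * w) = permLength w + 1 := by
  have key : inversions (s i * w) =
      insert (lo i, hi i) ((inversions w).map ((s i).prodCongr (s i)).toEmbedding) := by
    ext ⟨a, b⟩
    have hsymm : (s i).symm = s i := s_inv i
    simp only [inversions, Finset.mem_insert, Finset.mem_map_equiv, Finset.mem_filter,
      Finset.mem_univ, true_and, mul_inv_rev, s_inv, Equiv.Perm.mul_apply, Equiv.prodCongr_symm,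
      Equiv.prodCongr_apply, Prod.map, hsymm, Prod.mk.injEq]
    constructor
    · rintro ⟨hab, hf⟩
      by_cases hc : a = lo i ∧ b = hi i
      · exact Or.inl hc
      · exact Or.inr ⟨s_lt_s i hab hc, hf⟩
    · rintro (⟨rfl, rfl⟩ | ⟨hab, hf⟩)
      · simpa [lo_lt_hi] using h
      · refine ⟨?_, hf⟩
        have := s_lt_s i hab (fun hc => ?_)
        · simpa using this
        · rw [hc.1, hc.2] at hf
          exact lt_asymm h hf
  rw [permLength, key, Finset.card_insert_of_notMem, Finset.card_map, permLength]
  have hsymm : (s i).symm = s i := s_inv i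
  simp only [inversions, Finset.mem_map_equiv, Equiv.prodCongr_symm, Equiv.prodCongr_apply,
    Prod.map, hsymm, s_lo, s_hi, Finset.mem_filter, not_and]
  exact fun _ h' => absurd h' (lt_asymm (lo_lt_hi i))

theorem inv_apply_lo_ne_inv_apply_hi (i : Fin (n - 1)) (w : Equiv.Perm (Fin n)) :
    w⁻¹ (lo i) ≠ w⁻¹ (hi i) :=
  fun h => (lo_lt_hi i).ne (w⁻¹.injective h)

theorem permLength_s_mul_of_gt {i : Fin (n - 1)} {w : Equiv.Perm (Fin n)}
    (h : w⁻¹ (hi i) < w⁻¹ (lo i)) :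
    permLength (s i * w) + 1 = permLength w := by
  rw [← permLength_s_mul_of_lt (i := i) (w := s i * w) (by simpa using h), s_mul_s_mul]

theorem permLength_s_mul_le (i : Fin (n - 1)) (w : Equiv.Perm (Fin n)) :
    permLength (s i * w) ≤ permLength w + 1 := by
  rcases lt_or_gt_of_ne (inv_apply_lo_ne_inv_apply_hi i w) with h | h
  · exact (permLength_s_mul_of_lt h).le
  · have := permLength_s_mul_of_gt h
    omega

/-- Without a descent `w⁻¹` is strictly increasing, and a finite chain has no order automorphism but
the identity. -/
theorem exists_descent {w : Equiv.Perm (Fin n)} (hw : w ≠ 1) :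
    ∃ i : Fin (n - 1), w⁻¹ (hi i) < w⁻¹ (lo i) := by
  by_contra! hcon
  apply hw
  cases n with
  | zero => exact Subsingleton.elim _ _
  | succ m =>
    have hmono : StrictMono (w⁻¹ : Equiv.Perm (Fin (m + 1))) := by
      rw [Fin.strictMono_iff_lt_succ]
      exact fun i => lt_of_le_of_ne (hcon i) (inv_apply_lo_ne_inv_apply_hi (n := m + 1) i w)
    have : (w⁻¹ : Equiv.Perm (Fin (m + 1))) = 1 := by
      ext1 a
      exact DFunLike.congr_fun (Subsingleton.elim
        (hmono.orderIsoOfSurjective _ w⁻¹.surjective) (OrderIso.refl _)) a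
    simpa using this

theorem exists_list_length_eq_permLength (w : Equiv.Perm (Fin n)) :
    ∃ L : List (Fin (n - 1)), (L.map s).prod = w ∧ L.length = permLength w := by
  induction h : permLength w using Nat.strong_induction_on generalizing w with
  | _ m ih =>
    subst h
    by_cases hw : w = 1
    · exact ⟨[], by simp [hw]⟩
    · obtain ⟨i, hi⟩ := exists_descent hw
      have hlen := permLength_s_mul_of_gt hi
      obtain ⟨L, hL, hL'⟩ := ih _ (by omega) (s i * w) rfl
      exact ⟨i :: L, by simp [hL], by simp [hL', hlen]⟩

theorem permLength_prod_le (L : List (Fin (n - 1))) : permLength (L.map s).prod ≤ L.length := by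
  induction L with
  | nil => simp
  | cons i L ih =>
    have := permLength_s_mul_le i (L.map s).prod
    simp only [List.map_cons, List.prod_cons, List.length_cons]
    omega

/-- Removing descents produces a word of length `permLength w`, while each letter raises the length
by at most one, so no word is shorter. Minimality becomes a numerical equality. -/
theorem isReducedExpr_iff {w : Equiv.Perm (Fin n)} {L : List (Fin (n - 1))} :
    IsReducedExpr w L ↔ (L.map s).prod = w ∧ L.length = permLength w := by
  refine and_congr_right fun hL => ⟨fun h => ?_, fun h L' hL' => ?_⟩
  · obtain ⟨L', hL', hlen⟩ := exists_list_length_eq_permLength w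
    have h1 := permLength_prod_le L
    have h2 := h L' hL'
    rw [hL] at h1
    omega
  · have := permLength_prod_le L'
    rw [hL'] at this
    omega

theorem permLength_inv_le (w : Equiv.Perm (Fin n)) : permLength w⁻¹ ≤ permLength w := by
  obtain ⟨L, hL, hlen⟩ := exists_list_length_eq_permLength w
  have h := permLength_prod_le L.reverse
  have hprod : (L.reverse.map s).prod = w⁻¹ := by
    rw [← hL, List.prod_inv_reverse, List.map_map, List.map_reverse]
    simp [Function.comp_def]
  rw [hprod] at h
  simpa [hlen] using h

theorem permLength_inv (w : Equiv.Perm (Fin n)) : permLength w⁻¹ = permLength w :=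
  le_antisymm (permLength_inv_le w) (by simpa using permLength_inv_le w⁻¹)

/-- Removing the first letter of a reduced expression. -/
theorem isReducedExpr_cons_iff {w : Equiv.Perm (Fin n)} {i : Fin (n - 1)} {L : List (Fin (n - 1))} :
    IsReducedExpr w (i :: L) ↔ w⁻¹ (hi i) < w⁻¹ (lo i) ∧ IsReducedExpr (s i * w) L := by
  simp only [isReducedExpr_iff, List.map_cons, List.prod_cons, List.length_cons]
  constructor
  · rintro ⟨rfl, h2⟩
    have h3 := permLength_prod_le L
    simp only [s_mul_s_mul]
    rcases lt_or_gt_of_ne (inv_apply_lo_ne_inv_apply_hi i (s i * (L.map s).prod)) with h | h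
    · have := permLength_s_mul_of_lt h
      rw [s_mul_s_mul] at this
      omega
    · have := permLength_s_mul_of_gt h
      rw [s_mul_s_mul] at this
      exact ⟨h, trivial, by omega⟩
  · rintro ⟨h1, h2, h3⟩
    have := permLength_s_mul_of_gt h1
    exact ⟨by rw [h2, s_mul_s_mul], by omega⟩

end Length

/-! ### Relations in the algebra and among simple transpositions. -/

section Relations

variable {d n : ℕ}

theorem g_mul_g_of_far {i j : Fin (n - 1)} (h : i.val + 1 < j.val ∨ j.val + 1 < i.val) :
    g d i * g d j = g d j * g d i := by
  simpa only [map_mul, g, t] using RingQuot.mkAlgHom_rel GroundRing (Rel.b1 (d := d) i j h)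

theorem g_braid {i j : Fin (n - 1)} (h : j.val = i.val + 1) :
    g d i * g d j * g d i = g d j * g d i * g d j := by
  simpa only [map_mul, g, t] using RingQuot.mkAlgHom_rel GroundRing (Rel.b2 (d := d) i j h)

theorem t_mul_t (i j : Fin n) : t d i * t d j = t d j * t d i := by
  simpa only [map_mul, g, t] using RingQuot.mkAlgHom_rel GroundRing (Rel.f1 (d := d) i j)

theorem t_mul_g (i : Fin (n - 1)) (j : Fin n) : t d j * g d i = g d i * t d (s i j) := by
  simpa only [map_mul, g, t] using RingQuot.mkAlgHom_rel GroundRing (Rel.f2 (d := d) i j)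

/-- The image of `e_i` in the Yokonuma--Hecke algebra. -/
noncomputable def e (d : ℕ) {n : ℕ} (i : Fin (n - 1)) : Y d n :=
  RingQuot.mkAlgHom GroundRing (Rel d) (freeE d i)

theorem e_eq (i : Fin (n - 1)) : e d i = (LaurentPolynomial.C ((d : ℂ)⁻¹) : GroundRing) •
    ∑ s ∈ Finset.range d, t d (lo i) ^ s * t d (hi i) ^ (d - s) := by
  simp only [e, freeE, map_smul, map_sum, map_mul, map_pow, t]

theorem g_mul_g (i : Fin (n - 1)) : g d i * g d i = 1 + (q - qInv) • (e d i * g d i) := by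
  have h := RingQuot.mkAlgHom_rel GroundRing (Rel.quad (d := d) i)
  simpa only [map_add, map_one, map_smul, map_mul, pow_two, g, e] using h

theorem s_mul_s_of_far {i j : Fin (n - 1)} (h : i.val + 1 < j.val ∨ j.val + 1 < i.val) :
    s i * s j = s j * s i := by
  have : (s i).Disjoint (s j) := by
    intro x
    simp only [s, Equiv.swap_apply_def, lo, hi, Fin.ext_iff]
    split_ifs <;> simp_all <;> omega
  exact this.commute

theorem lo_eq_hi {i j : Fin (n - 1)} (h : j.val = i.val + 1) : lo j = hi i := Fin.ext h

theorem s_braid {i j : Fin (n - 1)} (h : j.val = i.val + 1) :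
    s i * s j * s i = s j * s i * s j := by
  have h2 : lo i ≠ hi j := fun h' => by simp only [lo, hi, Fin.ext_iff] at h'; omega
  have h3 : hi j ≠ hi i := fun h' => by simp only [hi, Fin.ext_iff] at h'; omega
  have e1 : s j * s i * s j = Equiv.swap (hi j) (lo i) := by
    rw [s, s, lo_eq_hi h, Equiv.swap_mul_swap_mul_swap (lo_lt_hi i).ne h2]
  have e2 : s i * s j * s i = Equiv.swap (lo i) (hi j) := by
    rw [s, s, lo_eq_hi h, Equiv.swap_comm (lo i), Equiv.swap_comm (hi i) (hi j),
      Equiv.swap_mul_swap_mul_swap h3 h2.symm]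
  rw [e1, e2, Equiv.swap_comm]

theorem s_lo_of_far {i j : Fin (n - 1)} (h : i.val + 1 < j.val ∨ j.val + 1 < i.val) :
    s i (lo j) = lo j := by
  apply s_apply_of_ne <;> simp only [lo, hi, ne_eq, Fin.ext_iff] <;> omega

theorem s_hi_of_far {i j : Fin (n - 1)} (h : i.val + 1 < j.val ∨ j.val + 1 < i.val) :
    s i (hi j) = hi j := by
  apply s_apply_of_ne <;> simp only [lo, hi, ne_eq, Fin.ext_iff] <;> omega

theorem s_hi_of_adjacent {i j : Fin (n - 1)} (h : j.val = i.val + 1) : s i (hi j) = hi j := by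
  apply s_apply_of_ne <;> simp only [lo, hi, ne_eq, Fin.ext_iff] <;> omega

theorem s_lo_of_adjacent {i j : Fin (n - 1)} (h : j.val = i.val + 1) : s j (lo i) = lo i := by
  apply s_apply_of_ne <;> simp only [lo, hi, ne_eq, Fin.ext_iff] <;> omega

end Relations

/-! ### Independence of the reduced word, and multiplication by `g_i`. -/

section Matsumoto

variable {d n : ℕ}

theorem prod_g_eq_of_adjacent {w : Equiv.Perm (Fin n)}
    (ih : ∀ v : Equiv.Perm (Fin n), permLength v < permLength w → ∀ L L' : List (Fin (n - 1)),
      IsReducedExpr v L → IsReducedExpr v L' → (L.map (g d)).prod = (L'.map (g d)).prod)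
    {i j : Fin (n - 1)} (hij : j.val = i.val + 1) {K K' : List (Fin (n - 1))}
    (hK : IsReducedExpr w (i :: K)) (hK' : IsReducedExpr w (j :: K')) :
    ((i :: K).map (g d)).prod = ((j :: K').map (g d)).prod := by
  rw [isReducedExpr_cons_iff] at hK hK'
  obtain ⟨hi', hK⟩ := hK
  obtain ⟨hj', hK'⟩ := hK'
  have hlo := lo_eq_hi hij
  have hs1 := s_hi_of_adjacent hij
  have hs2 := s_lo_of_adjacent hij
  have hsj : s j (hi i) = hi j := by rw [← hlo, s_lo]
  have hsi : s i (lo j) = lo i := by rw [hlo, s_hi]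
  -- As `w` has descents at both `i` and `i+1`, the longest element of the parabolic `S_3` splits
  -- off on the left. With a common tail `M`, the words `iji M` and `jij M` are both reduced for
  -- `w`, and the braid relation links them.
  obtain ⟨M, hM⟩ := exists_reducedExpr (s i * (s j * (s i * w)))
  have hM' : IsReducedExpr (s j * (s i * (s j * w))) M := by
    have := s_braid hij
    simp only [← mul_assoc] at hM ⊢
    rwa [← this]
  have h1 : IsReducedExpr (s i * w) (j :: i :: M) := by
    simp only [isReducedExpr_cons_iff, mul_inv_rev, s_inv, Equiv.Perm.mul_apply, hs1, hs2, hsj,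
      hsi, s_lo]
    rw [hlo] at hj'
    exact ⟨hj'.trans hi', hj', hM⟩
  have h2 : IsReducedExpr (s j * w) (i :: j :: M) := by
    simp only [isReducedExpr_cons_iff, mul_inv_rev, s_inv, Equiv.Perm.mul_apply, hs1, hs2, hsj,
      hsi, s_hi]
    rw [hlo] at hj' ⊢
    exact ⟨hj'.trans hi', hi', hM'⟩
  have l1 := permLength_s_mul_of_gt hi'
  have l2 := permLength_s_mul_of_gt hj'
  rw [List.map_cons, List.prod_cons, ih _ (by omega) _ _ hK h1, List.map_cons (l := K'),
    List.prod_cons (l := K'.map _), ih _ (by omega) _ _ hK' h2]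
  simp only [List.map_cons, List.prod_cons, ← mul_assoc]
  rw [g_braid hij]

/-- Matsumoto's theorem for the words in the `g_i`. -/
theorem prod_g_eq_of_isReducedExpr {w : Equiv.Perm (Fin n)} {L L' : List (Fin (n - 1))}
    (hL : IsReducedExpr w L) (hL' : IsReducedExpr w L') :
    (L.map (g d)).prod = (L'.map (g d)).prod := by
  induction h : permLength w using Nat.strong_induction_on generalizing w L L' with
  | _ m ih =>
    subst h
    replace ih : ∀ v : Equiv.Perm (Fin n), permLength v < permLength w →
        ∀ L L' : List (Fin (n - 1)), IsReducedExpr v L → IsReducedExpr v L' →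
          (L.map (g d)).prod = (L'.map (g d)).prod :=
      fun v hv L L' hL hL' => ih _ hv hL hL' rfl
    have hlen := (isReducedExpr_iff.1 hL).2
    have hlen' := (isReducedExpr_iff.1 hL').2
    match L, L' with
    | [], [] => rfl
    | [], _ :: _ => simp at hlen hlen'; omega
    | _ :: _, [] => simp at hlen hlen'; omega
    | i :: K, j :: K' =>
      have hK := isReducedExpr_cons_iff.1 hL
      have hK' := isReducedExpr_cons_iff.1 hL'
      have l1 := permLength_s_mul_of_gt hK.1
      have l2 := permLength_s_mul_of_gt hK'.1
      rcases eq_or_ne i j with rfl | hne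
      · rw [List.map_cons, List.prod_cons, ih _ (by omega) _ _ hK.2 hK'.2, List.map_cons,
          List.prod_cons]
      · by_cases h1 : j.val = i.val + 1
        · exact prod_g_eq_of_adjacent ih h1 hL hL'
        by_cases h2 : i.val = j.val + 1
        · exact (prod_g_eq_of_adjacent ih h2 hL' hL).symm
        have hne' : i.val ≠ j.val := fun h => hne (Fin.ext h)
        have hfar : i.val + 1 < j.val ∨ j.val + 1 < i.val := by omega
        -- Two far descents can be stripped in either order, leaving one common tail `M`.
        obtain ⟨M, hM⟩ := exists_reducedExpr (s j * (s i * w))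
        have hM' : IsReducedExpr (s i * (s j * w)) M := by
          rwa [← mul_assoc, s_mul_s_of_far hfar, mul_assoc]
        have r1 : IsReducedExpr (s i * w) (j :: M) := by
          simpa only [isReducedExpr_cons_iff, mul_inv_rev, s_inv, Equiv.Perm.mul_apply,
            s_lo_of_far hfar, s_hi_of_far hfar] using ⟨hK'.1, hM⟩
        have r2 : IsReducedExpr (s j * w) (i :: M) := by
          simpa only [isReducedExpr_cons_iff, mul_inv_rev, s_inv, Equiv.Perm.mul_apply,
            s_lo_of_far hfar.symm, s_hi_of_far hfar.symm] using ⟨hK.1, hM'⟩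
        rw [List.map_cons, List.prod_cons, ih _ (by omega) _ _ hK.2 r1, List.map_cons (l := K'),
          List.prod_cons (l := K'.map _), ih _ (by omega) _ _ hK'.2 r2]
        simp only [List.map_cons, List.prod_cons, ← mul_assoc, g_mul_g_of_far hfar]

theorem gPerm_eq {w : Equiv.Perm (Fin n)} {L : List (Fin (n - 1))} (hL : IsReducedExpr w L) :
    (L.map (g d)).prod = gPerm d w :=
  prod_g_eq_of_isReducedExpr hL (exists_reducedExpr w).choose_spec

@[simp] theorem gPerm_one : gPerm d (1 : Equiv.Perm (Fin n)) = 1 := by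
  rw [← gPerm_eq (L := []) (isReducedExpr_iff.2 (by simp))]
  simp

theorem g_mul_gPerm_of_lt {i : Fin (n - 1)} {w : Equiv.Perm (Fin n)}
    (h : w⁻¹ (lo i) < w⁻¹ (hi i)) : g d i * gPerm d w = gPerm d (s i * w) := by
  obtain ⟨L, hL⟩ := exists_reducedExpr w
  have hL' : IsReducedExpr (s i * w) (i :: L) :=
    isReducedExpr_cons_iff.2 ⟨by simpa using h, by simpa using hL⟩
  rw [← gPerm_eq hL', List.map_cons, List.prod_cons, gPerm_eq hL]

theorem g_mul_gPerm_of_gt {i : Fin (n - 1)} {w : Equiv.Perm (Fin n)}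
    (h : w⁻¹ (hi i) < w⁻¹ (lo i)) :
    g d i * gPerm d w = gPerm d (s i * w) + (q - qInv) • (e d i * gPerm d w) := by
  have h1 : gPerm d w = g d i * gPerm d (s i * w) := by
    rw [g_mul_gPerm_of_lt (by simpa using h), s_mul_s_mul]
  rw [h1, ← mul_assoc, g_mul_g, add_mul, one_mul, smul_mul_assoc, mul_assoc]

theorem gPerm_mul_g_of_gt {i : Fin (n - 1)} {w : Equiv.Perm (Fin n)}
    (h : w (hi i) < w (lo i)) : gPerm d (w * s i) * g d i = gPerm d w := by
  obtain ⟨L, hL⟩ := exists_reducedExpr (w * s i)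
  rw [← gPerm_eq (w := w) (L := L ++ [i]), List.map_append, List.prod_append, gPerm_eq hL]
  · simp
  · rw [isReducedExpr_iff] at hL ⊢
    refine ⟨by simp [hL.1, mul_assoc], ?_⟩
    have := permLength_s_mul_of_gt (i := i) (w := w⁻¹) (by simpa using h)
    rw [List.length_append, hL.2, List.length_singleton, ← permLength_inv w, ← this,
      ← permLength_inv (w * s i), mul_inv_rev, s_inv]

end Matsumoto

/-! ### Framings as an image of `ℤ^n`. -/

section Framing

variable {d n : ℕ} [NeZero d]

theorem tUnit_commute (i j : Fin n) : Commute (tUnit d i) (tUnit d j) :=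
  Units.ext (t_mul_t i j)

theorem list_ofFn_zpow_add {G : Type*} [Group G] {m : ℕ} {u : Fin m → G}
    (hu : ∀ i j, Commute (u i) (u j)) (k l : Fin m → ℤ) :
    (List.ofFn fun i => u i ^ (k + l) i).prod =
      (List.ofFn fun i => u i ^ k i).prod * (List.ofFn fun i => u i ^ l i).prod := by
  induction m with
  | zero => simp
  | succ m ih =>
    simp only [List.ofFn_succ, List.prod_cons, Pi.add_apply, zpow_add]
    have h := ih (u := fun i => u i.succ) (fun i j => hu _ _) (fun i => k i.succ)
      (fun i => l i.succ)
    simp only [Pi.add_apply, zpow_add] at h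
    rw [h]
    have hc : Commute (u 0 ^ l 0) (List.ofFn fun i : Fin m => u i.succ ^ k i.succ).prod := by
      apply Commute.list_prod_right
      intro x hx
      obtain ⟨i, rfl⟩ := List.mem_ofFn.1 hx
      exact (hu _ _).zpow_zpow _ _
    simp only [mul_assoc]
    rw [← mul_assoc (u 0 ^ l 0), hc.eq, mul_assoc]

theorem framing_add (k l : Fin n → ℤ) : framing d (k + l) = framing d k * framing d l := by
  rw [framing, list_ofFn_zpow_add tUnit_commute, Units.val_mul, framing, framing]

@[simp] theorem framing_zero : framing d (0 : Fin n → ℤ) = 1 := by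
  simp [framing]

theorem framing_congr {k l : Fin n → ℤ} (h : ∀ i, (k i : ZMod d) = l i) :
    framing d k = framing d l := by
  simp only [framing]
  congr 3
  funext i
  have h1 : tUnit d i ^ (d : ℤ) = 1 := by
    rw [zpow_natCast]
    exact Units.ext (t_pow d i)
  obtain ⟨c, hc⟩ := ((ZMod.intCast_eq_intCast_iff_dvd_sub _ _ _).1 (h i))
  rw [eq_add_of_sub_eq hc, zpow_add, zpow_mul, h1, one_zpow, one_mul]

theorem list_ofFn_zpow_single {G : Type*} [Group G] {m : ℕ} (u : Fin m → G) (j : Fin m) :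
    (List.ofFn fun i => u i ^ (Pi.single j 1 : Fin m → ℤ) i).prod = u j := by
  induction m with
  | zero => exact j.elim0
  | succ m ih =>
    rw [List.ofFn_succ, List.prod_cons]
    induction j using Fin.cases with
    | zero => simp
    | succ j =>
      have h := ih (fun i => u i.succ) j
      simpa [Pi.single_apply] using h

theorem framing_single_one (j : Fin n) : framing d (Pi.single j 1) = t d j := by
  rw [framing, list_ofFn_zpow_single]
  rfl

theorem framing_nsmul (m : ℕ) (k : Fin n → ℤ) : framing d (m • k) = framing d k ^ m := by
  induction m with
  | zero => simp
  | succ m ih => rw [succ_nsmul, framing_add, ih, pow_succ]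

/-- The unit vectors generate `ℤ^n` as a group, so statements about framings reduce to single
generators `t_j`. -/
theorem framing_induction {P : (Fin n → ℤ) → Prop} (k : Fin n → ℤ) (zero : P 0)
    (add : ∀ k l, P k → P l → P (k + l)) (neg : ∀ k, P k → P (-k))
    (single : ∀ j, P (Pi.single j 1)) : P k := by
  rw [← Finset.univ_sum_single k]
  refine Finset.sum_induction _ P (fun _ _ => add _ _) zero fun j _ => ?_
  induction k j using Int.induction_on with
  | zero => simpa using zero
  | succ m ih => rw [Pi.single_add]; exact add _ _ ih (single j)
  | pred m ih =>
    rw [sub_eq_add_neg, Pi.single_add]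
    refine add _ _ ih ?_
    rw [Pi.single_neg]
    exact neg _ (single j)

theorem framing_neg_mul (k : Fin n → ℤ) : framing d (-k) * framing d k = 1 := by
  rw [← framing_add, neg_add_cancel, framing_zero]

theorem framing_mul_neg (k : Fin n → ℤ) : framing d k * framing d (-k) = 1 := by
  rw [← framing_add, add_neg_cancel, framing_zero]

theorem framing_mul_g (i : Fin (n - 1)) (k : Fin n → ℤ) :
    framing d k * g d i = g d i * framing d (k ∘ s i) := by
  induction k using framing_induction with
  | zero => simp [Pi.zero_comp]
  | add k l hk hl =>
    rw [framing_add, mul_assoc, hl, ← mul_assoc, hk, mul_assoc, ← framing_add]; rfl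
  | neg k hk =>
    have h1 : framing d ((-k) ∘ s i) = framing d (-(k ∘ s i)) := rfl
    calc framing d (-k) * g d i
        = framing d (-k) * g d i * (framing d (k ∘ s i) * framing d (-(k ∘ s i))) := by
          rw [framing_mul_neg, mul_one]
      _ = framing d (-k) * (g d i * framing d (k ∘ s i)) * framing d (-(k ∘ s i)) := by
          simp only [mul_assoc]
      _ = _ := by rw [← hk, ← mul_assoc, framing_neg_mul, one_mul, h1]
  | single j =>
    have h : (Pi.single j 1 : Fin n → ℤ) ∘ s i = Pi.single (s i j) 1 := by
      funext a
      have : s i a = j ↔ a = s i j := ⟨fun h => by simp [← h], fun h => by simp [h]⟩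
      simp [Pi.single_apply, this]
    rw [h, framing_single_one, framing_single_one, t_mul_g]

theorem gPerm_mul_framing (w : Equiv.Perm (Fin n)) (k : Fin n → ℤ) :
    gPerm d w * framing d k = framing d (k ∘ ⇑w⁻¹) * gPerm d w := by
  obtain ⟨L, hL⟩ := exists_reducedExpr w
  rw [← gPerm_eq hL, ← hL.1]
  clear hL
  induction L with
  | nil => simp
  | cons i L ih =>
    rw [List.map_cons, List.prod_cons, mul_assoc, ih, List.map_cons, List.prod_cons, ← mul_assoc,
      ← mul_assoc]
    congr 1
    rw [framing_mul_g]
    congr 2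
    funext a
    simp

theorem e_eq_framing (i : Fin (n - 1)) : e d i = (LaurentPolynomial.C ((d : ℂ)⁻¹) : GroundRing) •
    ∑ s ∈ Finset.range d, framing d (s • (Pi.single (lo i) 1 - Pi.single (hi i) 1)) := by
  rw [e_eq]
  congr 1
  refine Finset.sum_congr rfl fun m hm => ?_
  rw [← framing_single_one, ← framing_single_one, ← framing_nsmul, ← framing_nsmul, ← framing_add]
  refine framing_congr fun a => ?_
  have := (Finset.mem_range.1 hm).le
  simp [Nat.cast_sub this, sub_eq_add_neg, mul_add]

end Framing

/-! ### The standard elements span. -/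

section Spanning

variable {d n : ℕ} [NeZero d]

/-- The elements `t_1^{k_1} ⋯ t_n^{k_n} g_w`. -/
noncomputable def standard (d : ℕ) {n : ℕ} [NeZero d]
    (x : (Fin n → ZMod d) × Equiv.Perm (Fin n)) : Y d n :=
  framing d (fun i => ((x.1 i).val : ℤ)) * gPerm d x.2

theorem standard_intCast (k : Fin n → ℤ) (w : Equiv.Perm (Fin n)) :
    standard d (fun i => (k i : ZMod d), w) = framing d k * gPerm d w := by
  rw [standard, framing_congr (l := k)]
  intro i
  simp

theorem framing_mul_gPerm_mem (k : Fin n → ℤ) (w : Equiv.Perm (Fin n)) :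
    framing d k * gPerm d w ∈ Submodule.span GroundRing (Set.range (standard d (n := n))) :=
  Submodule.subset_span ⟨_, standard_intCast k w⟩

theorem t_mul_mem {y : Y d n} (j : Fin n)
    (hy : y ∈ Submodule.span GroundRing (Set.range (standard d (n := n)))) :
    t d j * y ∈ Submodule.span GroundRing (Set.range (standard d (n := n))) := by
  induction hy using Submodule.span_induction with
  | mem y hy =>
    obtain ⟨x, rfl⟩ := hy
    rw [standard, ← mul_assoc, ← framing_single_one, ← framing_add]
    exact framing_mul_gPerm_mem _ _
  | zero => simp
  | add y z _ _ hy hz => rw [mul_add]; exact add_mem hy hz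
  | smul a y _ hy => rw [mul_smul_comm]; exact Submodule.smul_mem _ _ hy

theorem g_mul_framing (i : Fin (n - 1)) (k : Fin n → ℤ) :
    g d i * framing d k = framing d (k ∘ s i) * g d i := by
  rw [framing_mul_g]
  congr 2
  funext a
  simp

theorem framing_mul_e_mul_mem (i : Fin (n - 1)) (k : Fin n → ℤ) (w : Equiv.Perm (Fin n)) :
    framing d k * (e d i * gPerm d w) ∈
      Submodule.span GroundRing (Set.range (standard d (n := n))) := by
  rw [e_eq_framing, smul_mul_assoc, mul_smul_comm, Finset.sum_mul, Finset.mul_sum]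
  refine Submodule.smul_mem _ _ (sum_mem fun m _ => ?_)
  rw [← mul_assoc, ← framing_add]
  exact framing_mul_gPerm_mem _ _

theorem g_mul_mem {y : Y d n} (i : Fin (n - 1))
    (hy : y ∈ Submodule.span GroundRing (Set.range (standard d (n := n)))) :
    g d i * y ∈ Submodule.span GroundRing (Set.range (standard d (n := n))) := by
  induction hy using Submodule.span_induction with
  | mem y hy =>
    obtain ⟨⟨k, w⟩, rfl⟩ := hy
    rw [standard, ← mul_assoc, g_mul_framing, mul_assoc]
    rcases lt_or_gt_of_ne (inv_apply_lo_ne_inv_apply_hi i w) with h | h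
    · rw [g_mul_gPerm_of_lt h]
      exact framing_mul_gPerm_mem _ _
    · rw [g_mul_gPerm_of_gt h, mul_add, mul_smul_comm]
      exact add_mem (framing_mul_gPerm_mem _ _)
        (Submodule.smul_mem _ _ (framing_mul_e_mul_mem _ _ _))
  | zero => simp
  | add y z _ _ hy hz => rw [mul_add]; exact add_mem hy hz
  | smul a y _ hy => rw [mul_smul_comm]; exact Submodule.smul_mem _ _ hy

theorem span_standard : Submodule.span GroundRing (Set.range (standard d (n := n))) = ⊤ := by
  rw [eq_top_iff]
  rintro y -
  obtain ⟨a, rfl⟩ := RingQuot.mkAlgHom_surjective GroundRing (Rel d (n := n)) y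
  -- Quantifying over every `z` in the span, rather than only `z = 1`, lets the product case of the
  -- induction compose.
  suffices H : ∀ z ∈ Submodule.span GroundRing (Set.range (standard d (n := n))),
      RingQuot.mkAlgHom GroundRing (Rel d) a * z ∈
        Submodule.span GroundRing (Set.range (standard d (n := n))) by
    have h1 := framing_mul_gPerm_mem (d := d) (0 : Fin n → ℤ) 1
    rw [framing_zero, gPerm_one, mul_one] at h1
    simpa using H 1 h1
  induction a using FreeAlgebra.induction with
  | grade0 r =>
    intro z hz
    rw [AlgHom.commutes, ← Algebra.smul_def]
    exact Submodule.smul_mem _ _ hz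
  | grade1 x =>
    intro z hz
    cases x with
    | g i => exact g_mul_mem i hz
    | t j => exact t_mul_mem j hz
  | mul a b ha hb =>
    intro z hz
    rw [map_mul, mul_assoc]
    exact ha _ (hb _ hz)
  | add a b ha hb =>
    intro z hz
    rw [map_add, add_mul]
    exact add_mem (ha _ hz) (hb _ hz)

end Spanning

/-! ### The representation on functions of coloured permutations. -/

section Representation

variable (d : ℕ) {n : ℕ}

/-- The action of `s_i` on coloured permutations. -/
def act (i : Fin (n - 1)) (x : (Fin n → ZMod d) × Equiv.Perm (Fin n)) :
    (Fin n → ZMod d) × Equiv.Perm (Fin n) :=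
  (x.1 ∘ s i, s i * x.2)

/-- The entries at `a` and `b` have the same colour and are in decreasing order. -/
def Desc {d : ℕ} (x : (Fin n → ZMod d) × Equiv.Perm (Fin n)) (a b : Fin n) : Prop :=
  x.1 a = x.1 b ∧ x.2⁻¹ b < x.2⁻¹ a

instance {d : ℕ} (x : (Fin n → ZMod d) × Equiv.Perm (Fin n)) (a b : Fin n) :
    Decidable (Desc x a b) :=
  inferInstanceAs (Decidable (_ ∧ _))

theorem desc_act (i : Fin (n - 1)) (x : (Fin n → ZMod d) × Equiv.Perm (Fin n)) (a b : Fin n) :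
    Desc (act d i x) a b ↔ Desc x (s i a) (s i b) := by
  simp [Desc, act]

theorem act_act (i : Fin (n - 1)) (x : (Fin n → ZMod d) × Equiv.Perm (Fin n)) :
    act d i (act d i x) = x := by
  ext <;> simp [act]

theorem act_comm {i j : Fin (n - 1)} (h : i.val + 1 < j.val ∨ j.val + 1 < i.val)
    (x : (Fin n → ZMod d) × Equiv.Perm (Fin n)) : act d i (act d j x) = act d j (act d i x) := by
  have := s_mul_s_of_far h
  simp only [act, ← mul_assoc, this, Function.comp_assoc, ← Equiv.Perm.coe_mul]

theorem act_braid {i j : Fin (n - 1)} (h : j.val = i.val + 1)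
    (x : (Fin n → ZMod d) × Equiv.Perm (Fin n)) :
    act d i (act d j (act d i x)) = act d j (act d i (act d j x)) := by
  have := s_braid h
  simp only [act, ← mul_assoc, this, Function.comp_assoc, ← Equiv.Perm.coe_mul]

/-- The operator on functions of coloured permutations by which `g_i` acts. -/
noncomputable def gOp (i : Fin (n - 1)) :
    Module.End GroundRing ((Fin n → ZMod d) × Equiv.Perm (Fin n) → GroundRing) where
  toFun F := fun x => F (act d i x) + if Desc x (lo i) (hi i) then (q - qInv) * F x else 0
  map_add' F F' := by
    funext x
    simp only [Pi.add_apply]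
    split_ifs <;> ring
  map_smul' r F := by
    funext x
    simp only [Pi.smul_apply, smul_eq_mul, RingHom.id_apply]
    split_ifs <;> ring

theorem gOp_apply (i : Fin (n - 1)) (F : (Fin n → ZMod d) × Equiv.Perm (Fin n) → GroundRing)
    (x : (Fin n → ZMod d) × Equiv.Perm (Fin n)) :
    gOp d i F x = F (act d i x) + if Desc x (lo i) (hi i) then (q - qInv) * F x else 0 := rfl

/-- Both sides vanish unless the three colours agree. Then the right side says that `c` precedes
both `a` and `b`, and the two left terms split this according to the order of `a` and `b`. -/
theorem desc_indicator (x : (Fin n → ZMod d) × Equiv.Perm (Fin n)) {a b : Fin n} (c : Fin n)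
    (hab : a ≠ b) :
    (if Desc x a c then (1 : GroundRing) else 0) * (if Desc x b a then 1 else 0) +
      (if Desc x a b then 1 else 0) * (if Desc x b c then 1 else 0) =
    (if Desc x b c then 1 else 0) * (if Desc x a c then 1 else 0) := by
  have hne : x.2⁻¹ a ≠ x.2⁻¹ b := fun h => hab (x.2⁻¹.injective h)
  by_cases h1 : x.1 a = x.1 b
  · by_cases h2 : x.1 b = x.1 c
    · simp only [Desc, h1, h2, true_and]
      generalize x.2⁻¹ a = u at *
      generalize x.2⁻¹ b = v at *
      generalize x.2⁻¹ c = w at *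
      split_ifs <;> simp <;> order
    · simp [Desc, h1, h2]
  · by_cases h2 : x.1 b = x.1 c
    · have h3 : ¬ x.1 a = x.1 c := fun h => h1 (h.trans h2.symm)
      simp [Desc, h1, h3]
    · simp [Desc, h1, h2, Ne.symm h1]

/-- Companion identity: with equal colours, `b` and `c` both precede `a`, split by the order of `b`
and `c`. -/
theorem desc_indicator' (x : (Fin n → ZMod d) × Equiv.Perm (Fin n)) {b c : Fin n} (a : Fin n)
    (hbc : b ≠ c) :
    (if Desc x a c then (1 : GroundRing) else 0) * (if Desc x c b then 1 else 0) +
      (if Desc x a b then 1 else 0) * (if Desc x b c then 1 else 0) =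
    (if Desc x a b then 1 else 0) * (if Desc x a c then 1 else 0) := by
  have hne : x.2⁻¹ b ≠ x.2⁻¹ c := fun h => hbc (x.2⁻¹.injective h)
  by_cases h1 : x.1 a = x.1 b
  · by_cases h2 : x.1 b = x.1 c
    · simp only [Desc, h1, h2, true_and]
      generalize x.2⁻¹ a = u at *
      generalize x.2⁻¹ b = v at *
      generalize x.2⁻¹ c = w at *
      split_ifs <;> simp <;> order
    · have h3 : ¬ x.1 a = x.1 c := fun h => h2 (h1.symm.trans h)
      simp [Desc, h2, h3]
  · by_cases h2 : x.1 b = x.1 c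
    · have h3 : ¬ x.1 a = x.1 c := fun h => h1 (h.trans h2.symm)
      simp [Desc, h1, h3]
    · simp [Desc, h1, h2, Ne.symm h2]

theorem gOp_comm {i j : Fin (n - 1)} (h : i.val + 1 < j.val ∨ j.val + 1 < i.val) :
    gOp d i * gOp d j = gOp d j * gOp d i := by
  refine LinearMap.ext fun F => funext fun x => ?_
  simp only [Module.End.mul_apply, gOp_apply, desc_act, s_lo_of_far h, s_hi_of_far h,
    s_lo_of_far h.symm, s_hi_of_far h.symm, act_comm d h]
  split_ifs <;> ring

theorem gOp_braid {i j : Fin (n - 1)} (h : j.val = i.val + 1) :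
    gOp d i * gOp d j * gOp d i = gOp d j * gOp d i * gOp d j := by
  refine LinearMap.ext fun F => funext fun x => ?_
  have hsj : s j (hi i) = hi j := by rw [← lo_eq_hi h, s_lo]
  have hsj' : s j (hi j) = hi i := by rw [← lo_eq_hi h, s_hi]
  simp only [Module.End.mul_apply, gOp_apply, desc_act, lo_eq_hi h, s_hi_of_adjacent h,
    s_lo_of_adjacent h, hsj, hsj', s_lo, s_hi, act_act, act_braid d h]
  have hne : hi i ≠ hi j := fun h' => by simp only [hi, Fin.ext_iff] at h'; omega
  have hite : ∀ (D : Prop) [Decidable D] (r : GroundRing),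
      (if D then r else 0) = (if D then 1 else 0) * r := fun D _ r => by split_ifs <;> simp
  have id1 := desc_indicator d x (hi j) (lo_lt_hi i).ne
  have id2 := desc_indicator' d x (lo i) hne
  have hsq : ∀ (D : Prop) [Decidable D],
      (if D then (1 : GroundRing) else 0) * (if D then 1 else 0) = if D then 1 else 0 :=
    fun D _ => by split_ifs <;> simp
  simp only [hite _ (_ * _)]
  -- The two sides differ only in the coefficients of `F` at `act d i x`, at `act d j x` and at `x`;
  -- the first two match by `id1` and `id2`, the last because indicators are idempotent.
  linear_combination (q - qInv) ^ 2 * F (act d i x) * id1 - (q - qInv) ^ 2 * F (act d j x) * id2 +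
    (q - qInv) ^ 3 * F x * (if Desc x (hi i) (hi j) then 1 else 0) * hsq (Desc x (lo i) (hi i)) -
    (q - qInv) ^ 3 * F x * (if Desc x (lo i) (hi i) then 1 else 0) * hsq (Desc x (hi i) (hi j))

variable [NeZero d]

/-- A faithful additive character of `ℤ/d` with values in the ground ring. -/
noncomputable def char (a : ZMod d) : GroundRing := LaurentPolynomial.C (ZMod.stdAddChar a)

theorem char_add (a b : ZMod d) : char d (a + b) = char d a * char d b := by
  rw [char, AddChar.map_add_eq_mul, map_mul, char, char]

@[simp] theorem char_zero : char d 0 = 1 := by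
  rw [char, AddChar.map_zero_eq_one, map_one]

theorem char_pow (a : ZMod d) (m : ℕ) : char d a ^ m = char d (m * a) := by
  rw [char, ← map_pow, ← AddChar.map_nsmul_eq_pow, nsmul_eq_mul, char]

theorem char_injective : Function.Injective (char d) :=
  (LaurentPolynomial.C (R := ℂ)).injective.comp ZMod.injective_stdAddChar

/-- The operator on functions of coloured permutations by which `t_j` acts. -/
noncomputable def tOp (j : Fin n) :
    Module.End GroundRing ((Fin n → ZMod d) × Equiv.Perm (Fin n) → GroundRing) where
  toFun F := fun x => char d (x.1 j) * F x
  map_add' F F' := by funext x; simp [mul_add]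
  map_smul' r F := by funext x; simp [mul_left_comm]

theorem tOp_apply (j : Fin n) (F : (Fin n → ZMod d) × Equiv.Perm (Fin n) → GroundRing)
    (x : (Fin n → ZMod d) × Equiv.Perm (Fin n)) : tOp d j F x = char d (x.1 j) * F x := rfl

theorem tOp_pow_apply (j : Fin n) (m : ℕ) (F : (Fin n → ZMod d) × Equiv.Perm (Fin n) → GroundRing)
    (x : (Fin n → ZMod d) × Equiv.Perm (Fin n)) :
    (tOp d j ^ m) F x = char d (x.1 j) ^ m * F x := by
  induction m with
  | zero => simp
  | succ m ih => rw [pow_succ', Module.End.mul_apply, tOp_apply, ih, pow_succ', mul_assoc]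

theorem tOp_comm (i j : Fin n) : tOp d i * tOp d j = tOp d j * tOp d i := by
  refine LinearMap.ext fun F => funext fun x => ?_
  simp only [Module.End.mul_apply, tOp_apply]
  ring

/-- The diagonal term of `gOp` fixes the permutation instead of swapping, but it lives only where
the colours at `lo i` and `hi i` agree, so there `t_j` and `t_{s_i(j)}` have the same eigenvalue. -/
theorem tOp_mul_gOp (i : Fin (n - 1)) (j : Fin n) :
    tOp d j * gOp d i = gOp d i * tOp d (s i j) := by
  refine LinearMap.ext fun F => funext fun x => ?_
  simp only [Module.End.mul_apply, tOp_apply, gOp_apply]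
  have h1 : (act d i x).1 (s i j) = x.1 j := by simp [act]
  rw [h1]
  split_ifs with h
  · have h2 : x.1 (s i j) = x.1 j := by
      by_cases ha : j = lo i
      · rw [ha, s_lo, h.1]
      by_cases hb : j = hi i
      · rw [hb, s_hi, h.1]
      rw [s_apply_of_ne i ha hb]
    rw [h2]
    ring
  · ring

theorem tOp_pow (j : Fin n) : tOp d j ^ d = 1 := by
  refine LinearMap.ext fun F => funext fun x => ?_
  simp [tOp_pow_apply, char_pow]

/-- The operator by which `e_i` acts. -/
noncomputable def eOp (i : Fin (n - 1)) :
    Module.End GroundRing ((Fin n → ZMod d) × Equiv.Perm (Fin n) → GroundRing) :=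
  (LaurentPolynomial.C ((d : ℂ)⁻¹) : GroundRing) •
    ∑ s ∈ Finset.range d, tOp d (lo i) ^ s * tOp d (hi i) ^ (d - s)

/-- For distinct colours the sum is a geometric one: times the difference of two distinct `d`-th
roots of unity it gives `1 - 1 = 0`, and the ground ring is a domain. -/
theorem sum_char (a b : ZMod d) :
    (LaurentPolynomial.C ((d : ℂ)⁻¹) : GroundRing) *
      ∑ s ∈ Finset.range d, char d a ^ s * char d b ^ (d - s) = if a = b then 1 else 0 := by
  have hone : ∀ a : ZMod d, char d a ^ d = 1 := fun a => by simp [char_pow]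
  split_ifs with h
  · subst h
    have : ∀ s ∈ Finset.range d, char d a ^ s * char d a ^ (d - s) = 1 := fun s hs => by
      rw [← pow_add, Nat.add_sub_cancel' (Finset.mem_range.1 hs).le, hone]
    rw [Finset.sum_congr rfl this]
    have hd : (d : ℂ) ≠ 0 := NeZero.ne _
    simp only [Finset.sum_const, Finset.card_range, nsmul_eq_mul, mul_one]
    rw [← map_natCast (LaurentPolynomial.C (R := ℂ)), ← map_mul, inv_mul_cancel₀ hd, map_one]
  · have h1 : char d a - char d b ≠ 0 := sub_ne_zero.2 fun h' => h (char_injective d h')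
    have h2 := (Commute.all (char d a) (char d b)).geom_sum₂_mul d
    rw [hone, hone, sub_self, mul_eq_zero, or_iff_left h1] at h2
    have h3 : ∑ s ∈ Finset.range d, char d a ^ s * char d b ^ (d - s) =
        (∑ s ∈ Finset.range d, char d a ^ s * char d b ^ (d - 1 - s)) * char d b := by
      rw [Finset.sum_mul]
      refine Finset.sum_congr rfl fun s hs => ?_
      rw [mul_assoc, ← pow_succ]
      congr 2
      have := Finset.mem_range.1 hs
      omega
    rw [h3, h2, zero_mul, mul_zero]

theorem eOp_apply (i : Fin (n - 1)) (F : (Fin n → ZMod d) × Equiv.Perm (Fin n) → GroundRing)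
    (x : (Fin n → ZMod d) × Equiv.Perm (Fin n)) :
    eOp d i F x = if x.1 (lo i) = x.1 (hi i) then F x else 0 := by
  have h := sum_char d (x.1 (lo i)) (x.1 (hi i))
  simp only [eOp, LinearMap.smul_apply, LinearMap.sum_apply, Pi.smul_apply, Finset.sum_apply,
    Module.End.mul_apply, tOp_pow_apply, smul_eq_mul, ← mul_assoc]
  rw [← Finset.sum_mul, ← mul_assoc, h]
  simp

/-- Where the two colours agree, exactly one of `x` and `act d i x` is a descent, which gives the
Hecke relation; where they differ, `gOp` is a swap and `eOp` is zero. -/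
theorem gOp_sq (i : Fin (n - 1)) : gOp d i ^ 2 = 1 + (q - qInv) • (eOp d i * gOp d i) := by
  refine LinearMap.ext fun F => funext fun x => ?_
  have h1 : x.2⁻¹ (lo i) ≠ x.2⁻¹ (hi i) := inv_apply_lo_ne_inv_apply_hi i x.2
  simp only [pow_two, Module.End.mul_apply, LinearMap.add_apply, LinearMap.smul_apply,
    Module.End.one_apply, Pi.add_apply, Pi.smul_apply, gOp_apply, eOp_apply, desc_act, act_act,
    s_lo, s_hi, smul_eq_mul]
  by_cases hc : x.1 (lo i) = x.1 (hi i)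
  · rcases lt_or_gt_of_ne h1 with h | h
    · have d1 : ¬ Desc x (lo i) (hi i) := fun h' => lt_asymm h h'.2
      have d2 : Desc x (hi i) (lo i) := ⟨hc.symm, h⟩
      simp [d1, d2, hc]
    · have d1 : Desc x (lo i) (hi i) := ⟨hc, h⟩
      have d2 : ¬ Desc x (hi i) (lo i) := fun h' => lt_asymm h h'.2
      simp [d1, d2, hc]
  · have d1 : ¬ Desc x (lo i) (hi i) := fun h' => hc h'.1
    have d2 : ¬ Desc x (hi i) (lo i) := fun h' => hc h'.1.symm
    simp [d1, d2, hc]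

/-- The operators by which the generators act. -/
noncomputable def genOp :
    Gen n → Module.End GroundRing ((Fin n → ZMod d) × Equiv.Perm (Fin n) → GroundRing)
  | .g i => gOp d i
  | .t j => tOp d j

theorem lift_freeG (i : Fin (n - 1)) :
    FreeAlgebra.lift GroundRing (genOp d) (freeG i) = gOp d i := by
  rw [freeG, FreeAlgebra.lift_ι_apply]; rfl

theorem lift_freeT (j : Fin n) : FreeAlgebra.lift GroundRing (genOp d) (freeT j) = tOp d j := by
  rw [freeT, FreeAlgebra.lift_ι_apply]; rfl

theorem lift_freeE (i : Fin (n - 1)) :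
    FreeAlgebra.lift GroundRing (genOp d) (freeE d i) = eOp d i := by
  simp only [freeE, eOp, map_smul, map_sum, map_mul, map_pow, lift_freeT]

theorem lift_genOp_rel ⦃a b : FreeAlgebra GroundRing (Gen n)⦄ (h : Rel d a b) :
    FreeAlgebra.lift GroundRing (genOp d) a = FreeAlgebra.lift GroundRing (genOp d) b := by
  cases h with
  | b1 i j h => simp only [map_mul, lift_freeG, gOp_comm d h]
  | b2 i j h => simp only [map_mul, lift_freeG, gOp_braid d h]
  | f1 i j => simp only [map_mul, lift_freeT, tOp_comm d i j]
  | f2 i j => simp only [map_mul, lift_freeG, lift_freeT, tOp_mul_gOp]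
  | f3 j => simp only [map_pow, map_one, lift_freeT, tOp_pow]
  | quad i =>
    simp only [map_pow, map_add, map_smul, map_mul, map_one, lift_freeG, lift_freeE, gOp_sq]

/-- The representation on functions of coloured permutations. -/
noncomputable def rep :
    Y d n →ₐ[GroundRing]
      Module.End GroundRing ((Fin n → ZMod d) × Equiv.Perm (Fin n) → GroundRing) :=
  RingQuot.liftAlgHom GroundRing ⟨FreeAlgebra.lift GroundRing (genOp d), lift_genOp_rel d⟩

theorem rep_g (i : Fin (n - 1)) : rep d (g d i) = gOp d i := by
  rw [rep, g, RingQuot.liftAlgHom_mkAlgHom_apply, lift_freeG]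

theorem rep_t (j : Fin n) : rep d (t d j) = tOp d j := by
  rw [rep, t, RingQuot.liftAlgHom_mkAlgHom_apply, lift_freeT]

theorem rep_framing_apply (k : Fin n → ℤ)
    (F : (Fin n → ZMod d) × Equiv.Perm (Fin n) → GroundRing)
    (x : (Fin n → ZMod d) × Equiv.Perm (Fin n)) :
    rep d (framing d k) F x = char d (∑ j, k j * x.1 j) * F x := by
  induction k using framing_induction generalizing F with
  | zero => simp
  | add k l hk hl =>
    rw [framing_add, map_mul, Module.End.mul_apply, hk, hl, ← mul_assoc, ← char_add,
      ← Finset.sum_add_distrib]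
    simp [add_mul]
  | neg k hk =>
    -- Feeding the inverse framing into the hypothesis for `k` shows that it acts by the inverse
    -- character value.
    have h := hk (rep d (framing d (-k)) F)
    rw [← Module.End.mul_apply, ← map_mul, framing_mul_neg, map_one, Module.End.one_apply] at h
    rw [h, ← mul_assoc, ← char_add, ← Finset.sum_add_distrib]
    simp
  | single j =>
    rw [framing_single_one, rep_t, tOp_apply]
    congr 2
    simp [Pi.single_apply]

-- Along a reduced word each letter is prepended at an ascent, so the diagonal term of `gOp` never
-- contributes and the indicator of `1` is simply transported to that of `w`.
open Classical in
theorem rep_gPerm_apply (w : Equiv.Perm (Fin n)) (x : (Fin n → ZMod d) × Equiv.Perm (Fin n)) :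
    rep d (gPerm d w) (fun x => if x.2 = 1 then 1 else 0) x = if x.2 = w then 1 else 0 := by
  obtain ⟨L, hL⟩ := exists_reducedExpr w
  rw [← gPerm_eq hL]
  induction L generalizing w x with
  | nil =>
    have : w = 1 := hL.1.symm
    simp [this]
  | cons i L ih =>
    rw [isReducedExpr_cons_iff] at hL
    rw [List.map_cons, List.prod_cons, map_mul, rep_g, Module.End.mul_apply, gOp_apply,
      ih _ _ hL.2, ih _ _ hL.2]
    have h1 : (act d i x).2 = s i * w ↔ x.2 = w := mul_right_inj _
    have h2 : x.2 = s i * w → ¬ Desc x (lo i) (hi i) := by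
      rintro h ⟨-, h'⟩
      rw [h] at h'
      exact lt_asymm hL.1 (by simpa using h')
    simp only [h1]
    by_cases h3 : x.2 = s i * w
    · simp [h2 h3]
    · simp [h3]

end Representation

/-! ### Linear independence and the standard basis. -/

section Basis

variable {d n : ℕ} [NeZero d]

open Classical in
theorem rep_standard_apply (x y : (Fin n → ZMod d) × Equiv.Perm (Fin n)) :
    rep d (standard d x) (fun x => if x.2 = 1 then 1 else 0) y =
      if y.2 = x.2 then char d (∑ j, x.1 j * y.1 j) else 0 := by
  rw [standard, map_mul, Module.End.mul_apply, rep_framing_apply, rep_gPerm_apply]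
  simp

/-- The character of `(ℤ/d)^n` attached to `k`. -/
noncomputable def piChar (k : Fin n → ZMod d) : Multiplicative (Fin n → ZMod d) →* GroundRing where
  toFun c := char d (∑ j, k j * c.toAdd j)
  map_one' := by simp
  map_mul' a b := by simp [mul_add, Finset.sum_add_distrib, char_add]

theorem piChar_injective : Function.Injective (piChar (d := d) (n := n)) := by
  intro k l h
  funext j
  have h1 := DFunLike.congr_fun h (Multiplicative.ofAdd (Pi.single j 1))
  apply char_injective d
  simpa [piChar, Pi.single_apply] using h1

theorem linearIndependent_standard : LinearIndependent GroundRing (standard d (n := n)) := by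
  classical
  refine (Fintype.linearIndependent_iff (R := GroundRing) (M := Y d n) (v := standard d)).2 ?_
  rintro a ha ⟨k, w⟩
  -- Dedekind's independence of characters; evaluating the given relation at points `(c, w)`
  -- isolates the coefficients with permutation `w`.
  have hind := (linearIndependent_monoidHom (Multiplicative (Fin n → ZMod d)) GroundRing).comp
    _ (piChar_injective (d := d) (n := n))
  rw [Fintype.linearIndependent_iff] at hind
  refine hind (fun k => a (k, w)) ?_ k
  funext c
  have h1 := congrFun (DFunLike.congr_fun (congrArg (rep d) ha) (fun x => if x.2 = 1 then 1 else 0))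
    (c.toAdd, w)
  simp only [map_sum, map_smul, LinearMap.sum_apply, LinearMap.smul_apply, Finset.sum_apply,
    Pi.smul_apply, rep_standard_apply, Fintype.sum_prod_type, map_zero, smul_eq_mul] at h1
  simpa [piChar] using h1

/-- The basis of the elements `t_1^{k_1} ⋯ t_n^{k_n} g_w`. -/
noncomputable def standardBasis (d n : ℕ) [NeZero d] :
    Module.Basis ((Fin n → ZMod d) × Equiv.Perm (Fin n)) GroundRing (Y d n) :=
  Module.Basis.mk linearIndependent_standard span_standard.ge

theorem standardBasis_intCast (k : Fin n → ℤ) (w : Equiv.Perm (Fin n)) :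
    standardBasis d n (fun i => (k i : ZMod d), w) = framing d k * gPerm d w := by
  rw [standardBasis, Module.Basis.mk_apply, standard_intCast]

end Basis

/-! ### The trace form and the dual basis. -/

section Trace

theorem modEq_zero_iff {d : ℕ} (k : ℤ) : k ≡ 0 [ZMOD d] ↔ (k : ZMod d) = 0 := by
  rw [← ZMod.intCast_eq_intCast_iff, Int.cast_zero]

variable {d n : ℕ} [NeZero d] {τ : Y d n →ₗ[GroundRing] GroundRing}

open Classical in
theorem IsTau.apply (hτ : IsTau d τ) (k : Fin n → ℤ) (w : Equiv.Perm (Fin n)) :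
    τ (framing d k * gPerm d w) = if w = 1 ∧ ∀ i, k i ≡ 0 [ZMOD d] then 1 else 0 := by
  split_ifs with h
  · exact (hτ k w).1 h
  · exact (hτ k w).2 h

open Classical in
theorem IsTau.apply_gPerm_mul_gPerm (hτ : IsTau d τ) (k : Fin n → ℤ)
    (w w' : Equiv.Perm (Fin n)) :
    τ (framing d k * gPerm d w * gPerm d w') =
      if w⁻¹ = w' ∧ ∀ i, k i ≡ 0 [ZMOD d] then 1 else 0 := by
  induction hm : permLength w using Nat.strong_induction_on generalizing w w' k with
  | _ m ih =>
    subst hm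
    by_cases hw : w = 1
    · rw [hw, gPerm_one, mul_one, hτ.apply, inv_one]
      exact if_congr (and_congr_left' eq_comm) rfl rfl
    -- A right descent of `w`: `g_w` is `gPerm d (w * s i) * g d i`, and the last factor is handed
    -- over to `g_{w'}`.
    obtain ⟨i, hi'⟩ := exists_descent (inv_ne_one.2 hw)
    rw [inv_inv] at hi'
    have hlt : permLength (w * s i) < permLength w := by
      have := permLength_s_mul_of_gt (i := i) (w := w⁻¹) (by rwa [inv_inv])
      rw [permLength_inv, ← permLength_inv, mul_inv_rev, inv_inv, s_inv] at this
      omega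
    have hcond : (w * s i)⁻¹ = s i * w' ↔ w⁻¹ = w' := by
      rw [mul_inv_rev, s_inv, mul_right_inj]
    rw [← gPerm_mul_g_of_gt hi', ← mul_assoc, mul_assoc _ (g d i)]
    rcases lt_or_gt_of_ne (inv_apply_lo_ne_inv_apply_hi i w') with h | h
    · rw [g_mul_gPerm_of_lt h, ih _ hlt _ _ _ rfl]
      simp only [hcond]
    · have hne : (w * s i)⁻¹ ≠ w' := by
        rintro rfl
        rw [inv_inv] at h
        exact lt_asymm hi' (by simpa using h)
      have hzero : τ (framing d k * gPerm d (w * s i) * (e d i * gPerm d w')) = 0 := by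
        rw [e_eq_framing, smul_mul_assoc, mul_smul_comm, Finset.sum_mul, Finset.mul_sum, map_smul,
          map_sum, Finset.sum_eq_zero, smul_zero]
        intro m _
        rw [← mul_assoc, mul_assoc (framing d k), gPerm_mul_framing, ← mul_assoc, ← framing_add,
          ih _ hlt _ _ _ rfl, if_neg fun h => hne h.1]
      rw [g_mul_gPerm_of_gt h, mul_add, mul_smul_comm, map_add, map_smul, hzero, smul_zero,
        add_zero, ih _ hlt _ _ _ rfl]
      simp only [hcond]

-- Moving `t^l` to the left permutes its exponents by `w * w'`, which is trivial precisely in the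
-- case where `τ` can be nonzero.
open Classical in
theorem IsTau.apply_mul_framing (hτ : IsTau d τ) (k l : Fin n → ℤ) (w w' : Equiv.Perm (Fin n)) :
    τ (framing d k * gPerm d w * gPerm d w' * framing d l) =
      if w⁻¹ = w' ∧ ∀ i, k i + l i ≡ 0 [ZMOD d] then 1 else 0 := by
  rw [mul_assoc, gPerm_mul_framing, ← mul_assoc, mul_assoc (framing d k), gPerm_mul_framing,
    ← mul_assoc, ← framing_add, hτ.apply_gPerm_mul_gPerm]
  refine if_congr (and_congr_right ?_) rfl rfl
  rintro rfl
  simp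

open Classical in
/-- The values of `τ` on products of basis elements. -/
theorem IsTau.apply_mul (hτ : IsTau d τ) (k l : Fin n → ℤ) (w w' : Equiv.Perm (Fin n)) :
    τ (framing d k * gPerm d w * (framing d l * gPerm d w')) =
      if w⁻¹ = w' ∧ ∀ i, k i + l (w⁻¹ i) ≡ 0 [ZMOD d] then 1 else 0 := by
  rw [← mul_assoc, mul_assoc (framing d k), gPerm_mul_framing, ← mul_assoc, ← framing_add,
    hτ.apply_gPerm_mul_gPerm]
  rfl

theorem exists_eq_intCast (x : (Fin n → ZMod d) × Equiv.Perm (Fin n)) :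
    ∃ (k : Fin n → ℤ) (w : Equiv.Perm (Fin n)), x = (fun i => (k i : ZMod d), w) :=
  ⟨fun i => (x.1 i).val, x.2, by simp⟩

theorem existsUnique_isTau : ∃! τ : Y d n →ₗ[GroundRing] GroundRing, IsTau d τ := by
  classical
  refine ⟨(standardBasis d n).constr GroundRing fun x => if x = (0, 1) then 1 else 0, ?_, ?_⟩
  · intro k w
    rw [← standardBasis_intCast, Module.Basis.constr_basis]
    have : ((fun i => (k i : ZMod d), w) : (Fin n → ZMod d) × Equiv.Perm (Fin n)) = (0, 1) ↔
        w = 1 ∧ ∀ i, k i ≡ 0 [ZMOD d] := by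
      simp only [Prod.mk.injEq, funext_iff, modEq_zero_iff, and_comm, Pi.zero_apply]
    exact ⟨fun h => if_pos (this.2 h), fun h => if_neg fun h' => h (this.1 h')⟩
  · intro τ hτ
    refine (standardBasis d n).ext fun x => ?_
    obtain ⟨k, w, rfl⟩ := exists_eq_intCast x
    rw [Module.Basis.constr_basis, standardBasis_intCast, hτ.apply]
    refine if_congr ?_ rfl rfl
    simp only [Prod.mk.injEq, funext_iff, modEq_zero_iff, and_comm, Pi.zero_apply]

theorem IsTau.mul_comm (hτ : IsTau d τ) (a a' : Y d n) : τ (a * a') = τ (a' * a) := by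
  classical
  have key : (LinearMap.mul GroundRing (Y d n)).compr₂ τ =
      ((LinearMap.mul GroundRing (Y d n)).compr₂ τ).flip := by
    refine (standardBasis d n).ext fun x => (standardBasis d n).ext fun y => ?_
    obtain ⟨k, w, rfl⟩ := exists_eq_intCast x
    obtain ⟨l, w', rfl⟩ := exists_eq_intCast y
    simp only [LinearMap.flip_apply, LinearMap.compr₂_apply, LinearMap.mul_apply',
      standardBasis_intCast, hτ.apply_mul]
    refine if_congr ⟨?_, ?_⟩ rfl rfl
    · rintro ⟨rfl, h⟩
      refine ⟨by simp, fun i => ?_⟩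
      simpa [add_comm] using h (w i)
    · rintro ⟨rfl, h⟩
      refine ⟨by simp, fun i => ?_⟩
      simpa [add_comm] using h (w' i)
  exact LinearMap.congr_fun₂ key a a'

variable (d n) in
/-- The involution of the index set that relates the standard basis to its dual basis. -/
def dualIndex : Equiv.Perm ((Fin n → ZMod d) × Equiv.Perm (Fin n)) :=
  Function.Involutive.toPerm (fun x => (-(x.1 ∘ x.2), x.2⁻¹)) fun x => by
    ext <;> simp

variable (d n) in
/-- The basis dual to the standard basis. -/
noncomputable def dualBasis :
    Module.Basis ((Fin n → ZMod d) × Equiv.Perm (Fin n)) GroundRing (Y d n) :=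
  (standardBasis d n).reindex (dualIndex d n)

/-- Moving the framing to the left of `g_{w⁻¹}` composes its exponents with `w`, and `d` vanishes
modulo `d`; this is the standard element with index `dualIndex`. -/
theorem dualBasis_intCast (k : Fin n → ℤ) (w : Equiv.Perm (Fin n)) :
    dualBasis d n (fun i => (k i : ZMod d), w) =
      gPerm d w⁻¹ * framing d (fun i => (d : ℤ) - k i) := by
  rw [gPerm_mul_framing, ← standardBasis_intCast, dualBasis, Module.Basis.reindex_apply]
  congr 1
  ext <;> simp [dualIndex, Function.Involutive.toPerm]

theorem IsTau.dualBasis_mul (hτ : IsTau d τ) (x y : (Fin n → ZMod d) × Equiv.Perm (Fin n)) :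
    τ (dualBasis d n x * standardBasis d n y) = if x = y then 1 else 0 := by
  classical
  obtain ⟨k, w, rfl⟩ := exists_eq_intCast x
  obtain ⟨l, w', rfl⟩ := exists_eq_intCast y
  rw [dualBasis_intCast, standardBasis_intCast, gPerm_mul_framing, hτ.apply_mul]
  refine if_congr ?_ rfl rfl
  simp only [Prod.mk.injEq, funext_iff, modEq_zero_iff, Function.comp_apply, inv_inv]
  rw [and_comm]
  refine and_congr ?_ Iff.rfl
  rw [← w.forall_congr_right (q := fun i => (k i : ZMod d) = l i)]
  refine forall_congr' fun i => ?_
  push_cast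
  rw [CharP.cast_eq_zero, zero_sub, neg_add_eq_zero]

theorem IsTau.isSymmetrisingForm (hτ : IsTau d τ) :
    IsSymmetrisingForm GroundRing (Y d n) τ where
  trace := hτ.mul_comm
  nondegenerate := by
    refine ⟨_, (dualBasis d n).reindex (Fintype.equivFin _),
      (standardBasis d n).reindex (Fintype.equivFin _), ?_⟩
    have : (Matrix.of fun i j => τ ((dualBasis d n).reindex (Fintype.equivFin _) i *
        (standardBasis d n).reindex (Fintype.equivFin _) j)) = 1 := by
      ext1 i j
      simp [hτ.dualBasis_mul, Matrix.one_apply]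
    rw [this, Matrix.det_one]
    exact isUnit_one

end Trace

end YokonumaHecke

open YokonumaHecke in
theorem proposition7p2 (d n : ℕ) [NeZero d] :
    -- `g_w` does not depend on the reduced expression of `w`
    (∀ (w : Equiv.Perm (Fin n)) (L : List (Fin (n - 1))), IsReducedExpr w L →
      (L.map (g d)).prod = gPerm d w) ∧
    -- the elements `t^k g_w` form a basis
    ∃ B : Module.Basis ((Fin n → ZMod d) × Equiv.Perm (Fin n)) GroundRing (Y d n),
      (∀ (k : Fin n → ℤ) (w : Equiv.Perm (Fin n)),
        B (fun i => (k i : ZMod d), w) = framing d k * gPerm d w) ∧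
      -- `τ` is well defined
      (∃! τ : Y d n →ₗ[GroundRing] GroundRing, IsTau d τ) ∧
      ∀ τ : Y d n →ₗ[GroundRing] GroundRing, IsTau d τ →
        -- the multiplication formula
        (∀ (k l : Fin n → ℤ) (w w' : Equiv.Perm (Fin n)),
          ((w⁻¹ = w' ∧ ∀ i, k i + l i ≡ 0 [ZMOD d]) →
            τ (framing d k * gPerm d w * gPerm d w' * framing d l) = 1) ∧
          (¬ (w⁻¹ = w' ∧ ∀ i, k i + l i ≡ 0 [ZMOD d]) →
            τ (framing d k * gPerm d w * gPerm d w' * framing d l) = 0)) ∧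
        IsSymmetrisingForm GroundRing (Y d n) τ ∧
        -- the dual basis
        ∃ Bdual : Module.Basis ((Fin n → ZMod d) × Equiv.Perm (Fin n)) GroundRing (Y d n),
          (∀ (k : Fin n → ℤ) (w : Equiv.Perm (Fin n)),
            Bdual (fun i => (k i : ZMod d), w) =
              gPerm d w⁻¹ * framing d (fun i => (d : ℤ) - k i)) ∧
          (∀ x, τ (Bdual x * B x) = 1) ∧ ∀ x y, x ≠ y → τ (Bdual x * B y) = 0 := by
  refine ⟨fun w L hL => gPerm_eq hL, standardBasis d n, standardBasis_intCast, existsUnique_isTau,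
    fun τ hτ => ⟨fun k l w w' => ?_, hτ.isSymmetrisingForm, dualBasis d n, dualBasis_intCast,
      fun x => ?_, fun x y hxy => ?_⟩⟩
  · rw [hτ.apply_mul_framing]
    exact ⟨fun h => if_pos h, fun h => if_neg h⟩
  · rw [hτ.dualBasis_mul, if_pos rfl]
  · rw [hτ.dualBasis_mul, if_neg hxy]
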